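/- Let $k$ be an algebraically closed field, let $q$ be a prime number different from the characteristic of $k$, and let $f,g\in k[[x,y]]$ be irreducible (in particular nonzero) power series. Write $A=k[[x,y]]/(f)$, let $K(A)$ be the field of fractions of $A$, and let $\overline{A}$ be the normalization of $A$, that is, the integral closure of $A$ in $K(A)$. Consider the two conditions (a) the residue class of $g$ is a $q$-th power in $\overline{A}$; (b) there are $s,t$ in the field of fractions $k((x,y))$ of $k[[x,y]]$, both without pole along $f=0$ (that is, both of the form $a/b$ with $a,b\in k[[x,y]]$ and $f\nmid b$), such that the residue class of $s$ in $K(A)$ lies in $\overline{A}$ and $$g-s^q=f\,t .$$ Conditions (a) and (b) are equivalent. If $f$ is a $q$-th power modulo $g$, that is, if $f\equiv h^q \pmod g$ for some $h\in k[[x,y]]$, then (a) and (b) hold. -/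

import Mathlib

/-- The formal power series ring `k[[x,y]]` in two variables. -/
abbrev PowerSeriesXY (k : Type*) [CommRing k] : Type _ := MvPowerSeries (Fin 2) k

/-- The ring `R/(f)`: the coordinate ring of the curve `f = 0`. -/
abbrev CurveRing {R : Type*} [CommRing R] (f : R) : Type _ := R ⧸ Ideal.span {f}

/-- The ring of fractions of `R/(f)` (its field of fractions when `f` is prime):
the function field of the curve `f = 0`. -/
abbrev CurveFunctionField {R : Type*} [CommRing R] (f : R) : Type _ :=
  FractionRing (CurveRing f)

/-- The normalization of a ring `A`: the integral closure of `A` in its ring of fractions. -/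
abbrev normalization (A : Type*) [CommRing A] : Subalgebra A (FractionRing A) :=
  integralClosure A (FractionRing A)

/-- The residue class of `a : R` in the normalization of `R/(f)`. -/
abbrev classInNormalization {R : Type*} [CommRing R] (f a : R) : normalization (CurveRing f) :=
  algebraMap (CurveRing f) (normalization (CurveRing f)) (Ideal.Quotient.mk (Ideal.span {f}) a)

/-- `a` is a `q`-th power modulo `m`. -/
def IsPowMod {R : Type*} [CommRing R] (q : ℕ) (a m : R) : Prop :=
  ∃ h : R, m ∣ a - h ^ q

/-- The fraction `s` has no pole along `f = 0`: it can be written `a / b` with `f ∤ b`,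
that is, it lies in the localization of `R` at `(f)`. -/
def RegularAlong {R : Type*} [CommRing R] (f : R) (s : FractionRing R) : Prop :=
  ∃ a b : R, ¬ f ∣ b ∧ s * algebraMap R (FractionRing R) b = algebraMap R (FractionRing R) a

/-- The fraction `s` has no pole along `f = 0` and its residue class in the function field of
the curve `f = 0` is `u`: one has `s = a / b` with `f ∤ b`, and `u` is the quotient of the
classes of `a` and `b`. -/
def HasResidue {R : Type*} [CommRing R] (f : R) (s : FractionRing R)
    (u : CurveFunctionField f) : Prop :=
  ∃ a b : R, ¬ f ∣ b ∧ s * algebraMap R (FractionRing R) b = algebraMap R (FractionRing R) a ∧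
    u * algebraMap (CurveRing f) (CurveFunctionField f) (Ideal.Quotient.mk (Ideal.span {f}) b) =
      algebraMap (CurveRing f) (CurveFunctionField f) (Ideal.Quotient.mk (Ideal.span {f}) a)

/-! The normalization of A is a discrete valuation ring with residue field k. As k is algebraically
closed and q is invertible in k, a nonzero element of K(A) is a q-th power as soon as q divides its
order. The order of g along f = 0 is the intersection multiplicity (f·g), which is symmetric. If f ≡
h^q mod g, the order of f along g = 0 is q times that of h, so q divides (f·g) and g has a q-th
root.

Weierstrass preparation replaces f and g by polynomials D and E over k[[x]]. Then (f·g) is the order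
of the norm of g from k[[x]][y]/(D), which equals the order of Res(D, E) by
`AdjoinRoot.norm_mk_eq_resultant` and is thus symmetric. The root comes from
`exists_pow_eq_of_dvd_normOrder`. The line x = 0 has no Weierstrass polynomial and is treated apart.

Conditions (a) and (b) both amount to f ∣ g b^q - a^q for some a, b with f ∤ b. -/

/-! ### Expansions in powers of a uniformizer, and q-th roots of units -/

section Expansion

open PowerSeries Finset

variable {k B : Type*} [Field k] [CommRing B] [Algebra k⟦X⟧ B]

theorem PowerSeries.mk_eq_C_add_X_mul (a : ℕ → k) :
    PowerSeries.mk a = C (a 0) + X * PowerSeries.mk (fun m => a (m + 1)) := by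
  ext n
  cases n with
  | zero => simp
  | succ n => simp [coeff_succ_X_mul]

/-- Writing j = e m + i regroups an expansion into e power series in X. The second summand on the
left is the tail after e N digits, so no infinite sum in B is needed. -/
theorem sum_range_mul_add_X_pow_mul (τ : B) (e : ℕ) (c : ℕ → k) (N : ℕ) :
    ∑ j ∈ range (e * N), algebraMap k⟦X⟧ B (C (c j)) * (τ ^ (j % e) *
        algebraMap k⟦X⟧ B X ^ (j / e)) +
      algebraMap k⟦X⟧ B X ^ N * ∑ i ∈ range e,
        algebraMap k⟦X⟧ B (PowerSeries.mk fun m => c (e * (m + N) + i)) * τ ^ i =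
    ∑ i ∈ range e, algebraMap k⟦X⟧ B (PowerSeries.mk fun m => c (e * m + i)) * τ ^ i := by
  induction N with
  | zero => simp
  | succ N ih =>
    rw [← ih, mul_add, mul_one, sum_range_add, add_assoc]
    congr 1
    rw [mul_sum, mul_sum, ← sum_add_distrib]
    refine sum_congr rfl fun i hi => ?_
    have hi' : i < e := by simpa using hi
    rw [Nat.mul_add_mod, Nat.mod_eq_of_lt hi', Nat.mul_add_div (by omega),
      Nat.div_eq_of_lt hi', add_zero,
      PowerSeries.mk_eq_C_add_X_mul (fun m => c (e * (m + N) + i))]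
    simp only [map_add, map_mul, zero_add, pow_succ]
    have : (fun m => c (e * (m + 1 + N) + i)) = fun m => c (e * (m + (N + 1)) + i) := by
      funext m; congr 2; ring
    rw [this]
    ring

/-- Successive approximation without assuming B complete: the M-th digit multiplies an element of
order M in τ, and the digits assemble into e series in k[[X]], where the limit exists. The predicate
`P` is left abstract to serve both expansions and q-th roots. -/
theorem exists_powerSeries_combination_approximating {τ : B} {e : ℕ} (he : 0 < e) {u : Bˣ}
    (hX : algebraMap k⟦X⟧ B X = u * τ ^ e) (P : ℕ → B → Prop) (h0 : P 0 0)
    (hstep : ∀ M S, P M S → ∃ c : k, P (M + 1) (S + algebraMap k⟦X⟧ B (C c) *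
      (τ ^ (M % e) * algebraMap k⟦X⟧ B X ^ (M / e)))) :
    ∃ p : ℕ → k⟦X⟧, ∀ M, ∃ S, P M S ∧
      τ ^ M ∣ ∑ i ∈ range e, algebraMap k⟦X⟧ B (p i) * τ ^ i - S := by
  choose! next hnext using hstep
  let S : ℕ → B := fun M => Nat.rec 0 (fun M S => S + algebraMap k⟦X⟧ B (C (next M S)) *
      (τ ^ (M % e) * algebraMap k⟦X⟧ B X ^ (M / e))) M
  let c : ℕ → k := fun M => next M (S M)
  have hSucc : ∀ M, S (M + 1) = S M + algebraMap k⟦X⟧ B (C (c M)) *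
      (τ ^ (M % e) * algebraMap k⟦X⟧ B X ^ (M / e)) := fun M => rfl
  have hS : ∀ M, S M = ∑ j ∈ range M, algebraMap k⟦X⟧ B (C (c j)) * (τ ^ (j % e) *
        algebraMap k⟦X⟧ B X ^ (j / e)) := by
    intro M
    induction M with
    | zero => rfl
    | succ M ih => rw [hSucc, sum_range_succ, ih]
  have hP : ∀ M, P M (S M) := by
    intro M
    induction M with
    | zero => exact h0
    | succ M ih => exact hnext M _ ih
  refine ⟨fun i => PowerSeries.mk fun m => c (e * m + i), fun M => ⟨S M, hP M, ?_⟩⟩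
  rw [← sum_range_mul_add_X_pow_mul τ e c M, hS, add_sub_right_comm]
  obtain ⟨d, hd⟩ := Nat.exists_eq_add_of_le (Nat.le_mul_of_pos_left M he)
  refine dvd_add ?_ (Dvd.dvd.mul_right ?_ _)
  · rw [hd, sum_range_add, add_sub_cancel_left]
    refine dvd_sum fun i _ => Dvd.dvd.mul_left ?_ _
    rw [hX, mul_pow, ← pow_mul, mul_left_comm, ← pow_add]
    refine Dvd.dvd.mul_left (pow_dvd_pow _ ?_) _
    have := Nat.mod_add_div (M + i) e
    omega
  · rw [hX, mul_pow, ← pow_mul]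
    exact Dvd.dvd.mul_left (pow_dvd_pow _ (Nat.le_mul_of_pos_left M he)) _

theorem pow_mod_mul_X_pow_div {τ : B} {e : ℕ} {u : Bˣ}
    (hX : algebraMap k⟦X⟧ B X = u * τ ^ e) (M : ℕ) :
    τ ^ (M % e) * algebraMap k⟦X⟧ B X ^ (M / e) = τ ^ M * (u ^ (M / e) : Bˣ) := by
  rw [hX, mul_pow, ← pow_mul, mul_left_comm, ← pow_add, Nat.mod_add_div, mul_comm]
  push_cast
  rfl

theorem exists_eq_sum_powerSeries_mul_pow {τ : B} {e : ℕ} (he : 0 < e) {u : Bˣ}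
    (hX : algebraMap k⟦X⟧ B X = u * τ ^ e)
    (hres : ∀ b : B, ∃ c : k, τ ∣ b - algebraMap k⟦X⟧ B (C c))
    (hsep : ∀ b : B, (∀ M, τ ^ M ∣ b) → b = 0) (b : B) :
    ∃ p : ℕ → k⟦X⟧, b = ∑ i ∈ range e, algebraMap k⟦X⟧ B (p i) * τ ^ i := by
  obtain ⟨p, hp⟩ := exists_powerSeries_combination_approximating he hX
    (fun M S => τ ^ M ∣ b - S) (by simp) (by
      rintro M S ⟨w, hw⟩
      obtain ⟨c, hc⟩ := hres (w * ((u ^ (M / e))⁻¹ : Bˣ))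
      refine ⟨c, ?_⟩
      rw [pow_mod_mul_X_pow_div hX, ← sub_sub, hw]
      have : τ ^ M * w - algebraMap k⟦X⟧ B (C c) * (τ ^ M * (u ^ (M / e) : Bˣ)) =
          τ ^ M * ((w * ((u ^ (M / e))⁻¹ : Bˣ) - algebraMap k⟦X⟧ B (C c)) *
            (u ^ (M / e) : Bˣ)) := by
        rw [sub_mul, Units.inv_mul_cancel_right]
        ring
      rw [this, pow_succ]
      exact mul_dvd_mul_left _ (hc.mul_right _))
  refine ⟨p, sub_eq_zero.mp (hsep _ fun M => ?_)⟩
  obtain ⟨S, h1, h2⟩ := hp M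
  have := dvd_sub h1 h2
  simpa using this

theorem exists_pow_eq_of_isUnit [IsDomain B] [IsAlgClosed k] {τ : B} (hτ : ¬ IsUnit τ) {e : ℕ}
    (he : 0 < e) {u : Bˣ} (hX : algebraMap k⟦X⟧ B X = u * τ ^ e)
    (hres : ∀ b : B, ∃ c : k, τ ∣ b - algebraMap k⟦X⟧ B (C c))
    (hsep : ∀ b : B, (∀ M, τ ^ M ∣ b) → b = 0) {q : ℕ} (hq : 0 < q) (hqk : (q : k) ≠ 0)
    {b : B} (hb : IsUnit b) : ∃ s : B, s ^ q = b := by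
  have hqB : IsUnit (q : B) := by
    have := ((IsUnit.mk0 _ hqk).map (C (R := k))).map (algebraMap k⟦X⟧ B)
    simpa using this
  obtain ⟨p, hp⟩ := exists_powerSeries_combination_approximating he hX
    -- Divisibility by τ^0 says nothing, so S = 0 is recorded at M = 0; the first digit is then a
    -- q-th root of the residue of b.
    (fun M S => τ ^ M ∣ S ^ q - b ∧ (M = 0 → S = 0)) (by simp) (by
      rintro M S ⟨⟨w, hw⟩, hM0⟩
      rcases Nat.eq_zero_or_pos M with rfl | hM
      · obtain ⟨c₀, hc₀⟩ := hres b
        obtain ⟨c, hc⟩ := IsAlgClosed.exists_pow_nat_eq c₀ hq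
        refine ⟨c, ?_, by simp⟩
        rw [hM0 rfl, ← dvd_neg]
        simpa [← hc] using hc₀
      · obtain ⟨v, hv⟩ : ∃ v : Bˣ, v = u ^ (M / e) := ⟨_, rfl⟩
        obtain ⟨w₀, hw₀⟩ := hres w
        obtain ⟨r, hr⟩ := hres (q * S ^ (q - 1) * v)
        -- The derivative q S^(q-1) is nonzero modulo τ because S^q ≡ b is a unit there; hence -w₀ /
        -- r solves the linearised equation for the next digit.
        have hr0 : r ≠ 0 := by
          rintro rfl
          rw [map_zero, map_zero, sub_zero, mul_comm (q : B), mul_assoc,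
            (hqB.mul v.isUnit).dvd_mul_right] at hr
          have h1 : τ ∣ S ^ q := hr.trans (pow_dvd_pow _ (Nat.sub_le _ _))
          have h2 : τ ∣ S ^ q - b := hw ▸ (dvd_pow_self _ hM.ne').mul_right _
          exact hτ (isUnit_of_dvd_unit ((dvd_sub_right h1).mp h2) hb)
        refine ⟨-w₀ / r, ?_, by simp⟩
        rw [pow_mod_mul_X_pow_div hX, ← hv]
        obtain ⟨z, hz⟩ := Polynomial.powAddExpansion S
          (algebraMap k⟦X⟧ B (C (-w₀ / r)) * (τ ^ M * v)) q
        rw [hz]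
        have hcr : algebraMap k⟦X⟧ B (C (-w₀ / r)) * algebraMap k⟦X⟧ B (C r) =
            - algebraMap k⟦X⟧ B (C w₀) := by
          rw [← map_mul, ← map_mul, div_mul_cancel₀ _ hr0]; simp
        generalize algebraMap k⟦X⟧ B (C (-w₀ / r)) = c at *
        obtain ⟨a₁, ha₁⟩ := hw₀
        obtain ⟨a₂, ha₂⟩ := hr
        obtain ⟨M, rfl⟩ := Nat.exists_eq_succ_of_ne_zero hM.ne'
        refine ⟨a₁ + c * a₂ + z * c ^ 2 * τ ^ M * v ^ 2, ?_⟩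
        simp only [Nat.succ_eq_add_one] at *
        linear_combination hw + τ ^ (M + 1) * ha₁ + τ ^ (M + 1) * c * ha₂ + τ ^ (M + 1) * hcr)
  refine ⟨∑ i ∈ range e, algebraMap k⟦X⟧ B (p i) * τ ^ i,
    sub_eq_zero.mp (hsep _ fun M => ?_)⟩
  obtain ⟨S, ⟨h1, -⟩, h2⟩ := hp M
  have := dvd_add (h2.trans (sub_dvd_pow_sub_pow _ _ q)) h1
  rwa [sub_add_sub_cancel] at this

end Expansion

/-! ### Hensel's lemma: integrality of an irreducible monic polynomial from its constant term -/

section HenselCoefficients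

open Polynomial IsLocalRing

variable {O F : Type*} [CommRing O] [IsLocalRing O]

theorem Polynomial.IsDistinguishedAt.dvd_of_coe_dvd [IsAdicComplete (maximalIdeal O) O]
    {D Q : O[X]} (hD : D.IsDistinguishedAt (maximalIdeal O))
    (h : (D : PowerSeries O) ∣ (Q : PowerSeries O)) : D ∣ Q := by
  have h1 : hD.algEquivQuotient (Ideal.Quotient.mk _ Q) = 0 := by
    rw [hD.algEquivQuotient_apply]
    exact Ideal.Quotient.eq_zero_iff_mem.mpr (Ideal.mem_span_singleton.mpr h)
  rw [EmbeddingLike.map_eq_zero_iff] at h1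
  exact Ideal.mem_span_singleton.mp (Ideal.Quotient.eq_zero_iff_mem.mp h1)

/-- If the leading coefficient is not a unit, neither is the constant one. The Weierstrass factor D
of Q then splits Q properly: D = 1 would make Q(0) a unit, and a unit cofactor would make the
leading coefficient a unit. -/
theorem Polynomial.isUnit_leadingCoeff_of_irreducible [IsDomain O]
    [IsAdicComplete (maximalIdeal O) O]
    {Q : O[X]} (hQ : Irreducible Q) (hprim : Q.map (residue O) ≠ 0)
    (h0 : Q.leadingCoeff ∣ Q.coeff 0) : IsUnit Q.leadingCoeff := by
  by_contra hlc
  have hlc' : residue O Q.leadingCoeff = 0 := by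
    rwa [residue_eq_zero_iff, mem_maximalIdeal, mem_nonunits_iff]
  have h0' : residue O (Q.coeff 0) = 0 := by
    obtain ⟨c, hc⟩ := h0
    rw [hc, map_mul, hlc', zero_mul]
  have hmap : (Q : PowerSeries O).map (residue O) ≠ 0 := by
    rw [← Polynomial.polynomial_map_coe]
    exact_mod_cast hprim
  obtain ⟨D, H, hDH⟩ := PowerSeries.exists_isWeierstrassFactorization hmap
  have hD := hDH.isDistinguishedAt
  obtain ⟨A, hA⟩ := hD.dvd_of_coe_dvd ⟨H, hDH.eq_mul⟩
  have hHA : H = A := by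
    have h1 := hDH.eq_mul
    rw [hA, Polynomial.coe_mul] at h1
    refine (mul_left_cancel₀ ?_ h1).symm
    exact_mod_cast hD.monic.ne_zero
  rcases hQ.isUnit_or_isUnit hA with h | h
  · have hD1 := hD.monic.eq_one_of_isUnit h
    have hAu : IsUnit (A.coeff 0) := by
      have := PowerSeries.isUnit_iff_constantCoeff.mp (hHA ▸ hDH.isUnit)
      simpa using this
    rw [hD1, one_mul] at hA
    rw [hA] at h0'
    exact (hAu.map (residue O)).ne_zero h0'
  · rw [hA, leadingCoeff_mul, hD.monic.leadingCoeff, one_mul] at hlc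
    obtain ⟨r, hr, rfl⟩ := Polynomial.isUnit_iff.mp h
    rw [leadingCoeff_C] at hlc
    exact hlc hr

/-- The primitive integral multiple Q = r P is irreducible by Gauss's lemma and has leading
coefficient r, which divides Q(0) = r P(0). So r is a unit. -/
theorem Polynomial.exists_map_eq_of_monic_irreducible [IsDomain O] [IsPrincipalIdealRing O]
    [IsAdicComplete (maximalIdeal O) O] [Field F] [Algebra O F] [IsFractionRing O F]
    {P : F[X]} (hP : P.Monic) (hirr : Irreducible P)
    (h0 : P.coeff 0 ∈ (algebraMap O F).range) : ∃ Q : O[X], Q.map (algebraMap O F) = P := by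
  classical
  let _ : NormalizedGCDMonoid O := Classical.choice inferInstance
  obtain ⟨b, hb, hbP⟩ := IsLocalization.integerNormalization_spec (nonZeroDivisors O) P
  generalize IsLocalization.integerNormalization (nonZeroDivisors O) P = Q₀ at hbP
  have hinj := IsFractionRing.injective O F
  have hb0 : algebraMap O F b ≠ 0 := by
    simpa using nonZeroDivisors.ne_zero hb
  have hbP' : Q₀.map (algebraMap O F) = C (algebraMap O F b) * P := by
    rw [hbP, ← Polynomial.smul_eq_C_mul, algebraMap_smul]
  have hQ₀ : Q₀ ≠ 0 := by
    intro h
    rw [h, Polynomial.map_zero] at hbP'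
    exact mul_ne_zero (C_ne_zero.mpr hb0) hP.ne_zero hbP'.symm
  have hc : algebraMap O F Q₀.content ≠ 0 := by
    simpa [content_eq_zero_iff] using hQ₀
  set Q := Q₀.primPart
  obtain ⟨r, hr⟩ : ∃ r, r = algebraMap O F b / algebraMap O F Q₀.content := ⟨_, rfl⟩
  have hr0 : r ≠ 0 := hr ▸ div_ne_zero hb0 hc
  have hQP : Q.map (algebraMap O F) = C r * P := by
    have h1 := congrArg (Polynomial.map (algebraMap O F)) Q₀.eq_C_content_mul_primPart
    rw [hbP', Polynomial.map_mul, map_C] at h1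
    apply mul_left_cancel₀ (C_ne_zero.mpr hc)
    rw [← h1, ← mul_assoc, ← C_mul, hr, mul_div_cancel₀ _ hc]
  have hQirr : Irreducible Q := by
    rw [Q₀.isPrimitive_primPart.irreducible_iff_irreducible_map_fraction_map (K := F), hQP]
    exact (irreducible_isUnit_mul (isUnit_C.mpr hr0.isUnit)).mpr hirr
  have hrlc : algebraMap O F Q.leadingCoeff = r := by
    rw [← leadingCoeff_map_of_injective hinj, hQP, leadingCoeff_mul, hP.leadingCoeff]
    simp
  have hprim : Q.map (residue O) ≠ 0 := by
    intro h
    have hdvd : ∀ n, Q.coeff n ∈ maximalIdeal O := fun n => by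
      rw [← residue_eq_zero_iff, ← coeff_map, h, coeff_zero]
    obtain ⟨ϖ, hϖ⟩ := (IsPrincipalIdealRing.principal (maximalIdeal O)).principal
    have hϖ' : ¬ IsUnit ϖ := by
      rw [← mem_nonunits_iff, ← mem_maximalIdeal, hϖ]
      exact Ideal.mem_span_singleton_self ϖ
    refine hϖ' (Q₀.isPrimitive_primPart ϖ ?_)
    rw [C_dvd_iff_dvd_coeff]
    intro n
    have := hdvd n
    rw [hϖ] at this
    exact Ideal.mem_span_singleton.mp this
  have hu : IsUnit Q.leadingCoeff := by
    refine isUnit_leadingCoeff_of_irreducible hQirr hprim ?_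
    obtain ⟨a, ha⟩ := h0
    refine ⟨a, hinj ?_⟩
    rw [← coeff_map, hQP, coeff_C_mul, map_mul, hrlc, ha]
  obtain ⟨v, hv⟩ := hu.exists_left_inv
  refine ⟨C v * Q, ?_⟩
  rw [Polynomial.map_mul, map_C, hQP, ← mul_assoc, ← C_mul, ← hrlc, ← map_mul, hv]
  simp

end HenselCoefficients

/-! ### The order of the norm as a valuation on finite extensions of k((X)) -/

section OrderOfNorm

open scoped PowerSeries LaurentSeries

instance PowerSeries.isAdicComplete_maximalIdeal (k : Type*) [Field k] :
    IsAdicComplete (IsLocalRing.maximalIdeal k⟦X⟧) k⟦X⟧ := by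
  rw [PowerSeries.maximalIdeal_eq_span_X]
  infer_instance

variable {k : Type*} [Field k]

theorem LaurentSeries.order_nonneg_iff (f : k⸨X⸩) :
    0 ≤ f.order ↔ f ∈ (algebraMap k⟦X⟧ k⸨X⸩).range := by
  change _ ↔ f ∈ (HahnSeries.ofPowerSeries ℤ k).range
  constructor
  · intro h
    obtain ⟨n, hn⟩ := Int.eq_ofNat_of_zero_le h
    exact ⟨_, LaurentSeries.X_order_mul_powerSeriesPart hn.symm⟩
  · rintro ⟨p, rfl⟩
    by_contra! h
    have hne : (HahnSeries.ofPowerSeries ℤ k p) ≠ 0 := by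
      rintro h0
      rw [h0, HahnSeries.order_zero] at h
      exact lt_irrefl _ h
    apply hne
    rw [← HahnSeries.coeff_order_eq_zero]
    have := PowerSeries.coeff_coe p (HahnSeries.ofPowerSeries ℤ k p).order
    rwa [if_pos h] at this

theorem LaurentSeries.order_X : (algebraMap k⟦X⟧ k⸨X⸩ PowerSeries.X).order = 1 := by
  rw [LaurentSeries.coe_algebraMap, PowerSeries.coe_X, HahnSeries.order_single one_ne_zero]

variable {L : Type*} [Field L] [Algebra k⸨X⸩ L]

variable (k) in
/-- The order of the norm of an element of an extension of `k((X))`. -/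
noncomputable def normOrder (a : L) : ℤ := (Algebra.norm k⸨X⸩ a).order

variable [FiniteDimensional k⸨X⸩ L]

theorem normOrder_mul {a b : L} (ha : a ≠ 0) (hb : b ≠ 0) :
    normOrder k (a * b) = normOrder k a + normOrder k b := by
  rw [normOrder, map_mul, HahnSeries.order_mul (Algebra.norm_ne_zero_iff.mpr ha)
    (Algebra.norm_ne_zero_iff.mpr hb)]
  rfl

omit [FiniteDimensional k⸨X⸩ L] in
theorem normOrder_one : normOrder k (1 : L) = 0 := by
  rw [normOrder, map_one, HahnSeries.order_one]

theorem normOrder_inv {a : L} (ha : a ≠ 0) : normOrder k a⁻¹ = - normOrder k a := by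
  have := normOrder_mul (k := k) ha (inv_ne_zero ha)
  rw [mul_inv_cancel₀ ha, normOrder_one] at this
  linarith

theorem normOrder_div {a b : L} (ha : a ≠ 0) (hb : b ≠ 0) :
    normOrder k (a / b) = normOrder k a - normOrder k b := by
  rw [div_eq_mul_inv, normOrder_mul ha (inv_ne_zero hb), normOrder_inv hb, sub_eq_add_neg]

omit [FiniteDimensional k⸨X⸩ L] in
theorem normOrder_pow (a : L) (n : ℕ) : normOrder k (a ^ n) = n * normOrder k a := by
  rw [normOrder, map_pow, HahnSeries.order_pow, nsmul_eq_mul]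
  rfl

theorem normOrder_zpow {a : L} (ha : a ≠ 0) (n : ℤ) : normOrder k (a ^ n) = n * normOrder k a := by
  obtain ⟨n, rfl | rfl⟩ := n.eq_nat_or_neg
  · rw [zpow_natCast, normOrder_pow]
  · rw [zpow_neg, zpow_natCast, normOrder_inv (pow_ne_zero _ ha), normOrder_pow]
    ring

variable [Algebra k⟦X⟧ L] [IsScalarTower k⟦X⟧ k⸨X⸩ L]

theorem normOrder_X :
    normOrder k (algebraMap k⟦X⟧ L PowerSeries.X) = Module.finrank k⸨X⸩ L := by
  rw [normOrder, IsScalarTower.algebraMap_apply k⟦X⟧ k⸨X⸩ L, Algebra.norm_algebraMap,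
    HahnSeries.order_pow, LaurentSeries.order_X, nsmul_eq_mul, mul_one]

open Polynomial in
-- Up to sign the norm is a power of the constant term of the minimal polynomial, and Hensel's lemma
-- passes integrality from that term to all coefficients. The case a = 0 fits because the order of 0
-- is 0.
theorem isIntegral_iff_normOrder_nonneg (a : L) :
    IsIntegral k⟦X⟧ a ↔ 0 ≤ normOrder k a := by
  rw [normOrder, LaurentSeries.order_nonneg_iff]
  constructor
  · intro h
    exact IsIntegrallyClosed.isIntegral_iff.mp (Algebra.isIntegral_norm k⸨X⸩ h)
  · intro h
    have hint : IsIntegral k⸨X⸩ a := Algebra.IsIntegral.isIntegral a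
    have h0 : (minpoly k⸨X⸩ a).coeff 0 ∈ (algebraMap k⟦X⟧ k⸨X⸩).range := by
      rw [Algebra.norm_eq_norm_adjoin, ← LaurentSeries.order_nonneg_iff,
        HahnSeries.order_pow, nsmul_eq_mul] at h
      have hpos : (0 : ℤ) < Module.finrank (IntermediateField.adjoin k⸨X⸩ {a}) L := by
        exact_mod_cast Module.finrank_pos
      have h2 := nonneg_of_mul_nonneg_right h hpos
      rw [← IntermediateField.adjoin.powerBasis_gen hint,
        Algebra.PowerBasis.norm_gen_eq_coeff_zero_minpoly, IntermediateField.adjoin.powerBasis_gen,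
        IntermediateField.minpoly_gen] at h2
      rw [LaurentSeries.order_nonneg_iff] at h2
      have h3 := mul_mem (pow_mem (neg_mem (one_mem (algebraMap k⟦X⟧ k⸨X⸩).range))
        (IntermediateField.adjoin.powerBasis hint).dim) h2
      rwa [← mul_assoc, ← mul_pow, neg_mul_neg, one_mul, one_pow, one_mul] at h3
    obtain ⟨Q, hQ⟩ := Polynomial.exists_map_eq_of_monic_irreducible (O := k⟦X⟧)
      (minpoly.monic hint) (minpoly.irreducible hint) h0
    refine ⟨Q, ?_, ?_⟩
    · exact Polynomial.monic_of_injective (IsFractionRing.injective k⟦X⟧ k⸨X⸩)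
        (hQ ▸ minpoly.monic hint)
    · rw [← aeval_def, ← aeval_map_algebraMap k⸨X⸩, hQ, minpoly.aeval]

open Polynomial in
-- The residue field is k. An integral equation for a, reduced mod X, splits over k, so a product of
-- factors a - c is X times an integral element and has positive order; some factor must then vanish
-- or have positive order.
theorem exists_normOrder_sub_pos [IsAlgClosed k] {a : L} (ha : IsIntegral k⟦X⟧ a) :
    ∃ c : k, a = algebraMap k⟦X⟧ L (PowerSeries.C c) ∨
      0 < normOrder k (a - algebraMap k⟦X⟧ L (PowerSeries.C c)) := by
  by_contra! hcon
  obtain ⟨P, hP, hPa⟩ := ha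
  rw [← aeval_def] at hPa
  have hsplit := (IsAlgClosed.splits (P.map (PowerSeries.constantCoeff (R := k)))).eq_prod_roots
  rw [(hP.map _).leadingCoeff, C_1, one_mul] at hsplit
  set s := (P.map (PowerSeries.constantCoeff (R := k))).roots
  let W : k⟦X⟧[X] := (s.map fun c => X - C (PowerSeries.C c)).prod
  have hW : (P - W).map (PowerSeries.constantCoeff (R := k)) = 0 := by
    rw [Polynomial.map_sub, hsplit, Polynomial.map_multiset_prod, Multiset.map_map, sub_eq_zero]
    simp
  have hdvd : C (PowerSeries.X : k⟦X⟧) ∣ P - W := by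
    rw [C_dvd_iff_dvd_coeff]
    intro i
    rw [PowerSeries.X_dvd_iff, ← coeff_map, hW, coeff_zero]
  obtain ⟨Q, hQ⟩ := hdvd
  have hWa : ∀ t : Multiset k,
      (aeval a (t.map fun c => X - C (PowerSeries.C c)).prod : L) ≠ 0 ∧
      normOrder k (aeval a (t.map fun c => X - C (PowerSeries.C c)).prod : L) ≤ 0 := by
    intro t
    induction t using Multiset.induction_on with
    | empty => simp [normOrder_one]
    | cons c t ih =>
      have h1 : a - algebraMap k⟦X⟧ L (PowerSeries.C c) ≠ 0 := sub_ne_zero.mpr (hcon c).1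
      rw [Multiset.map_cons, Multiset.prod_cons, map_mul, map_sub, aeval_X, aeval_C]
      refine ⟨mul_ne_zero h1 ih.1, ?_⟩
      rw [normOrder_mul h1 ih.1]
      exact add_nonpos (hcon c).2 ih.2
  obtain ⟨h1, h2⟩ := hWa s
  have h3 : (aeval a W : L) = algebraMap k⟦X⟧ L PowerSeries.X * - aeval a Q := by
    have := congrArg (aeval a) hQ
    rw [map_sub, hPa, map_mul, aeval_C] at this
    rw [mul_neg, ← this]
    ring
  change (aeval a W : L) ≠ 0 at h1
  change normOrder k (aeval a W : L) ≤ 0 at h2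
  rw [h3] at h1 h2
  rw [normOrder_mul (left_ne_zero_of_mul h1) (right_ne_zero_of_mul h1), normOrder_X] at h2
  have h4 : 0 ≤ normOrder k (-aeval a Q : L) := by
    rw [← isIntegral_iff_normOrder_nonneg]
    refine IsIntegral.neg ?_
    exact adjoin_le_integralClosure ⟨P, hP, hPa⟩ (Q.aeval_mem_adjoin_singleton k⟦X⟧ a)
  have : (0 : ℤ) < Module.finrank k⸨X⸩ L := by exact_mod_cast Module.finrank_pos
  omega

end OrderOfNorm

/-! ### Uniformizers, total ramification and q-th roots in L -/

section Uniformizer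

open scoped PowerSeries LaurentSeries

variable {k : Type*} [Field k] {L : Type*} [Field L] [Algebra k⸨X⸩ L]
  [FiniteDimensional k⸨X⸩ L] [Algebra k⟦X⟧ L] [IsScalarTower k⟦X⟧ k⸨X⸩ L]

theorem integralClosure_dvd_iff {a b : integralClosure k⟦X⟧ L} (ha : a ≠ 0) (hb : b ≠ 0) :
    a ∣ b ↔ normOrder k (a : L) ≤ normOrder k (b : L) := by
  have ha' : (a : L) ≠ 0 := by simpa using ha
  have hb' : (b : L) ≠ 0 := by simpa using hb
  constructor
  · rintro ⟨c, rfl⟩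
    have hc' : (c : L) ≠ 0 := by simpa using right_ne_zero_of_mul hb
    rw [MulMemClass.coe_mul, normOrder_mul ha' hc']
    have := (isIntegral_iff_normOrder_nonneg (k := k) (c : L)).mp c.2
    omega
  · intro h
    refine ⟨⟨b / a, ?_⟩, Subtype.ext ?_⟩
    · change IsIntegral _ _
      rw [isIntegral_iff_normOrder_nonneg, normOrder_div hb' ha']
      omega
    · simp [mul_div_cancel₀ _ ha']

/-- The least positive value d generates the value group, by division with remainder. That d = 1
needs the residue field to be k and is shown later. -/
theorem exists_normOrder_minimal : ∃ (d : ℕ) (t : L), 0 < d ∧ t ≠ 0 ∧ normOrder k t = d ∧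
    ∀ a : L, a ≠ 0 → (d : ℤ) ∣ normOrder k a := by
  classical
  have hex : ∃ d : ℕ, 0 < d ∧ ∃ t : L, t ≠ 0 ∧ normOrder k t = d := by
    refine ⟨_, Module.finrank_pos, _, ?_, normOrder_X (k := k) (L := L)⟩
    rw [IsScalarTower.algebraMap_apply k⟦X⟧ k⸨X⸩ L]
    simp
  obtain ⟨hd, t, ht, htd⟩ := Nat.find_spec hex
  refine ⟨Nat.find hex, t, hd, ht, htd, fun a ha => ?_⟩
  have hd' : (0 : ℤ) < (Nat.find hex : ℕ) := by exact_mod_cast hd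
  generalize hdd : Nat.find hex = d at *
  by_contra hnd
  have hr0 := Int.emod_nonneg (normOrder k a) hd'.ne'
  have hr1 := Int.emod_lt_of_pos (normOrder k a) hd'
  have hr2 : normOrder k a % d ≠ 0 := fun h => hnd (Int.dvd_of_emod_eq_zero h)
  refine Nat.find_min hex (m := (normOrder k a % d).toNat) (by omega) ⟨by omega,
    a / t ^ (normOrder k a / d), div_ne_zero ha (zpow_ne_zero _ ht), ?_⟩
  rw [normOrder_div ha (zpow_ne_zero _ ht), normOrder_zpow ht, htd, Int.toNat_of_nonneg hr0,
    Int.emod_def, mul_comm]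

theorem finrank_le_of_integralClosure_spanned {e : ℕ} {t : L}
    (h : ∀ b : L, IsIntegral k⟦X⟧ b → ∃ p : ℕ → k⟦X⟧,
      b = ∑ i ∈ Finset.range e, algebraMap k⟦X⟧ L (p i) * t ^ i) :
    Module.finrank k⸨X⸩ L ≤ e := by
  have hspan : Submodule.span k⸨X⸩ (Set.range fun i : Fin e => t ^ (i : ℕ)) = ⊤ := by
    rw [eq_top_iff]
    rintro a -
    have halg : Algebra.IsAlgebraic k⟦X⟧ L :=
      (IsFractionRing.comap_isAlgebraic_iff (A := k⟦X⟧) (K := k⸨X⸩) (C := L)).mpr inferInstance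
    obtain ⟨r, hr, hra⟩ := (halg.isAlgebraic a).exists_integral_multiple
    obtain ⟨p, hp⟩ := h _ hra
    have hr' : algebraMap k⟦X⟧ k⸨X⸩ r ≠ 0 :=
      (map_ne_zero_iff _ (IsFractionRing.injective k⟦X⟧ k⸨X⸩)).mpr hr
    have : a = (algebraMap k⟦X⟧ k⸨X⸩ r)⁻¹ •
        ∑ i ∈ Finset.range e, algebraMap k⟦X⟧ L (p i) * t ^ i := by
      rw [← hp, ← algebraMap_smul k⸨X⸩ r a, inv_smul_smul₀ hr']
    rw [this]
    refine Submodule.smul_mem _ _ (Submodule.sum_mem _ fun i hi => ?_)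
    rw [IsScalarTower.algebraMap_apply k⟦X⟧ k⸨X⸩ L, ← Algebra.smul_def]
    exact Submodule.smul_mem _ _ (Submodule.subset_span ⟨⟨i, Finset.mem_range.mp hi⟩, rfl⟩)
  simpa using finrank_le_of_span_eq_top hspan

/-- Once t has norm order 1, a is t^(qm) times a unit of the integral closure, and that unit has a
q-th root. -/
theorem exists_pow_eq_of_dvd_normOrder [IsAlgClosed k] {q : ℕ} (hq : 0 < q)
    (hqk : (q : k) ≠ 0) {a : L} (ha : a ≠ 0) (hdvd : (q : ℤ) ∣ normOrder k a) :
    ∃ b : L, b ^ q = a := by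
  obtain ⟨d, t, hd, ht, htd, hall⟩ := exists_normOrder_minimal (k := k) (L := L)
  let B := integralClosure k⟦X⟧ L
  have hmem : ∀ x : L, x ∈ B ↔ 0 ≤ normOrder k x := isIntegral_iff_normOrder_nonneg
  let τ : B := ⟨t, (hmem t).mpr (by omega)⟩
  have hτ0 : τ ≠ 0 := fun h => ht (congrArg Subtype.val h)
  have hX0 : algebraMap k⟦X⟧ L PowerSeries.X ≠ 0 := by
    rw [IsScalarTower.algebraMap_apply k⟦X⟧ k⸨X⸩ L]
    simp
  have hunit : ∀ x : L, x ≠ 0 → ∀ h : normOrder k x = 0,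
      IsUnit (⟨x, (hmem x).mpr h.ge⟩ : B) := by
    intro x hx h
    rw [isUnit_iff_dvd_one, integralClosure_dvd_iff (fun h => hx (congrArg Subtype.val h))
      one_ne_zero]
    simp [h, normOrder_one]
  have hτu : ¬ IsUnit τ := by
    rw [isUnit_iff_dvd_one, integralClosure_dvd_iff hτ0 one_ne_zero]
    simp only [OneMemClass.coe_one, normOrder_one]
    change ¬ normOrder k t ≤ 0
    omega
  obtain ⟨e, he⟩ : d ∣ Module.finrank k⸨X⸩ L := by
    have := hall _ hX0
    rw [normOrder_X] at this
    exact_mod_cast this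
  have hn : 0 < Module.finrank k⸨X⸩ L := Module.finrank_pos
  have he0 : 0 < e := Nat.pos_of_mul_pos_left (he ▸ hn)
  obtain ⟨u, hu⟩ := hunit (algebraMap k⟦X⟧ L PowerSeries.X / t ^ e)
    (div_ne_zero hX0 (pow_ne_zero _ ht)) (by
      rw [normOrder_div hX0 (pow_ne_zero _ ht), normOrder_X, normOrder_pow, htd, he]
      push_cast
      ring)
  have hX : algebraMap k⟦X⟧ B PowerSeries.X = u * τ ^ e := by
    rw [hu]
    apply Subtype.ext
    change algebraMap k⟦X⟧ L PowerSeries.X = algebraMap k⟦X⟧ L PowerSeries.X / t ^ e * t ^ e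
    rw [div_mul_cancel₀ _ (pow_ne_zero _ ht)]
  have hres : ∀ b : B, ∃ c : k, τ ∣ b - algebraMap k⟦X⟧ B (PowerSeries.C c) := by
    intro b
    obtain ⟨c, hc | hc⟩ := exists_normOrder_sub_pos (k := k) b.2
    · refine ⟨c, ?_⟩
      have : b - algebraMap k⟦X⟧ B (PowerSeries.C c) = 0 := Subtype.ext (sub_eq_zero.mpr hc)
      rw [this]
      exact dvd_zero _
    · refine ⟨c, ?_⟩
      by_cases h0 : b - algebraMap k⟦X⟧ B (PowerSeries.C c) = 0
      · rw [h0]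
        exact dvd_zero _
      · rw [integralClosure_dvd_iff hτ0 h0]
        change normOrder k t ≤ normOrder k ((b : L) - algebraMap k⟦X⟧ L (PowerSeries.C c))
        rw [htd]
        exact Int.le_of_dvd hc (hall _ fun h => h0 (Subtype.ext h))
  have hsep : ∀ b : B, (∀ M, τ ^ M ∣ b) → b = 0 := by
    intro b hb
    by_contra hb0
    have h := hb ((normOrder k (b : L)).toNat + 1)
    rw [integralClosure_dvd_iff (pow_ne_zero _ hτ0) hb0] at h
    change normOrder k (t ^ _) ≤ _ at h
    rw [normOrder_pow, htd] at h
    have hb1 := (hmem b).mp b.2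
    have : (((normOrder k (b : L)).toNat + 1 : ℕ) : ℤ) ≤
        (((normOrder k (b : L)).toNat + 1 : ℕ) : ℤ) * d :=
      le_mul_of_one_le_right (by positivity) (by exact_mod_cast hd)
    omega
  -- L has degree d e, yet the expansions show that 1, t, ..., t^(e-1) span it.
  have hd1 : d = 1 := by
    have hle : Module.finrank k⸨X⸩ L ≤ e := by
      refine finrank_le_of_integralClosure_spanned (t := t) fun b hb => ?_
      obtain ⟨p, hp⟩ := exists_eq_sum_powerSeries_mul_pow he0 hX hres hsep ⟨b, hb⟩
      refine ⟨p, ?_⟩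
      have := congrArg B.val hp
      rw [map_sum] at this
      exact this
    rw [he] at hle
    have := Nat.le_of_mul_le_mul_right (hle.trans_eq (one_mul e).symm) he0
    omega
  obtain ⟨m, hm⟩ := hdvd
  have htm : t ^ m ≠ 0 := zpow_ne_zero _ ht
  have hv0 : normOrder k (a / (t ^ m) ^ q) = 0 := by
    rw [normOrder_div ha (pow_ne_zero _ htm), normOrder_pow, normOrder_zpow ht, htd, hm, hd1]
    push_cast
    ring
  obtain ⟨s, hs⟩ := exists_pow_eq_of_isUnit hτu he0 hX hres hsep hq hqk
    (hunit _ (div_ne_zero ha (pow_ne_zero _ htm)) hv0)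
  refine ⟨s * t ^ m, ?_⟩
  have hs' : (s : L) ^ q = a / (t ^ m) ^ q := congrArg Subtype.val hs
  rw [mul_pow, hs', div_mul_cancel₀ _ (pow_ne_zero _ htm)]

end Uniformizer

/-! ### The norm from S[X]/(f) as a resultant -/

section Resultant

open Polynomial

/-- Split p into linear factors: det(M - a) is, up to sign, the characteristic polynomial at a. -/
theorem Matrix.det_aeval_eq_resultant_charpoly {K : Type*} [Field K] [IsAlgClosed K]
    {n : Type*} [Fintype n] [DecidableEq n] (M : Matrix n n K) (p : K[X]) :
    (aeval M p).det = M.charpoly.resultant p := by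
  have hp := IsAlgClosed.splits p
  have hdeg := M.charpoly_natDegree_eq_dim
  have hdet : ∀ s : Multiset K, (aeval M (s.map fun a => X - C a).prod).det =
      (-1) ^ (Fintype.card n * s.card) * (s.map fun a => M.charpoly.eval a).prod := by
    intro s
    induction s using Multiset.induction_on with
    | empty => simp
    | cons a s ih =>
      have : M - algebraMap K _ a = -(Matrix.scalar n a - M) := by
        rw [neg_sub]; rfl
      simp only [Multiset.map_cons, Multiset.prod_cons, map_mul, Matrix.det_mul, ih, map_sub,
        aeval_X, aeval_C, Multiset.card_cons, Matrix.eval_charpoly, this, Matrix.det_neg]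
      ring
  rw [resultant_comm, resultant_eq_prod_eval p M.charpoly _ le_rfl hp]
  conv_lhs => rw [hp.eq_prod_roots]
  rw [map_mul, Matrix.det_mul, hdet, aeval_C, hdeg, ← hp.natDegree_eq_card_roots,
    Algebra.algebraMap_eq_smul_one, Matrix.det_smul, Matrix.det_one]
  ring

theorem AdjoinRoot.minpoly_root_of_monic {S : Type*} [CommRing S] [IsDomain S] {f : S[X]}
    (hf : f.Monic) : minpoly S (AdjoinRoot.root f) = f := by
  have hint : IsIntegral S (AdjoinRoot.root f) :=
    (AdjoinRoot.isAdjoinRootMonic f hf).isIntegral_root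
  refine (eq_of_monic_of_dvd_of_natDegree_le hf (minpoly.monic hint) ?_ ?_)
  · rw [← AdjoinRoot.mk_eq_zero, ← AdjoinRoot.aeval_eq, minpoly.aeval]
  · exact natDegree_le_natDegree (minpoly.min S _ hf (by simp))

theorem AdjoinRoot.norm_mk_eq_resultant {S : Type*} [CommRing S] [IsDomain S] {f : S[X]}
    (hf : f.Monic) (p : S[X]) : Algebra.norm S (AdjoinRoot.mk f p) = f.resultant p := by
  classical
  let pb := AdjoinRoot.powerBasis' hf
  have hcp : (Algebra.leftMulMatrix pb.basis pb.gen).charpoly = f := by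
    rw [charpoly_leftMulMatrix pb, AdjoinRoot.powerBasis'_gen, minpoly_root_of_monic hf]
  rw [Algebra.norm_eq_matrix_det pb.basis, ← AdjoinRoot.aeval_eq,
    ← AdjoinRoot.powerBasis'_gen hf, ← Polynomial.aeval_algHom_apply]
  change (aeval (Algebra.leftMulMatrix pb.basis pb.gen) p).det = _
  generalize Algebra.leftMulMatrix pb.basis pb.gen = M at hcp
  let K := AlgebraicClosure (FractionRing S)
  let φ : S →+* K := (algebraMap (FractionRing S) K).comp (algebraMap S (FractionRing S))
  have hφ : Function.Injective φ :=
    (algebraMap (FractionRing S) K).injective.comp (IsFractionRing.injective S _)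
  apply hφ
  have h1 : φ.mapMatrix (aeval M p) = aeval (M.map φ) (p.map φ) := by
    rw [aeval_def, aeval_def, Polynomial.hom_eval₂, eval₂_map]
    congr 1
    ext a i j
    simp [Matrix.algebraMap_matrix_apply, apply_ite φ]
  rw [← resultant_map_map, RingHom.map_det, h1, Matrix.det_aeval_eq_resultant_charpoly,
    Matrix.charpoly_map, hcp, natDegree_map_eq_of_injective hφ, natDegree_map_eq_of_injective hφ]

end Resultant

/-! ### Intersection multiplicities through Weierstrass polynomials -/

section WeierstrassCurves

open scoped PowerSeries LaurentSeries
open Polynomial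

variable {k : Type*} [Field k]

/-- The root is found in k((X))[Y]/(D), where the norm is unchanged since it is a resultant;
clearing denominators brings it back, with b a constant polynomial. -/
theorem Polynomial.exists_pow_modEq_of_dvd_order_norm [IsAlgClosed k] {q : ℕ} (hq : 0 < q)
    (hqk : (q : k) ≠ 0) {D p : k⟦X⟧[X]} (hD : D.Monic) (hirr : Irreducible D) (hp : ¬ D ∣ p)
    (hdvd : (q : ℤ) ∣
      (algebraMap k⟦X⟧ k⸨X⸩ (Algebra.norm k⟦X⟧ (AdjoinRoot.mk D p))).order) :
    ∃ a b : k⟦X⟧[X], ¬ D ∣ b ∧ D ∣ p * b ^ q - a ^ q := by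
  have hinj := IsFractionRing.injective k⟦X⟧ k⸨X⸩
  set P := D.map (algebraMap k⟦X⟧ k⸨X⸩) with hPdef
  have hP : P.Monic := hD.map _
  have hPirr : Irreducible P :=
    (hD.irreducible_iff_irreducible_map_fraction_map (K := k⸨X⸩)).mp hirr
  have : Fact (Irreducible P) := ⟨hPirr⟩
  have : FiniteDimensional k⸨X⸩ (AdjoinRoot P) := hP.finite_adjoinRoot
  have hmap : ∀ r : k⟦X⟧[X], D ∣ r ↔ AdjoinRoot.mk P (r.map (algebraMap k⟦X⟧ k⸨X⸩)) = 0 := by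
    intro r
    rw [AdjoinRoot.mk_eq_zero, map_dvd_map _ hinj hD]
  obtain ⟨β, hβ⟩ := exists_pow_eq_of_dvd_normOrder hq hqk
    (mt (hmap p).mpr hp) (by
      rwa [normOrder, AdjoinRoot.norm_mk_eq_resultant hP, resultant_map_map,
        natDegree_map_eq_of_injective hinj, natDegree_map_eq_of_injective hinj,
        ← AdjoinRoot.norm_mk_eq_resultant hD])
  obtain ⟨r, rfl⟩ := AdjoinRoot.mk_surjective β
  obtain ⟨c, hc, hcr⟩ := IsLocalization.integerNormalization_spec (nonZeroDivisors k⟦X⟧) r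
  refine ⟨IsLocalization.integerNormalization (nonZeroDivisors k⟦X⟧) r, C c, ?_, ?_⟩
  · intro h
    refine hirr.not_isUnit (isUnit_of_dvd_unit 
      ((map_dvd_map _ hinj hD).mp ?_) isUnit_one)
    refine (Polynomial.map_dvd (algebraMap k⟦X⟧ k⸨X⸩) h).trans ?_
    rw [map_C]
    rw [Polynomial.map_one]
    exact (isUnit_C.mpr ((map_ne_zero_iff _ hinj).mpr
      (nonZeroDivisors.ne_zero hc)).isUnit).dvd
  · rw [hmap, Polynomial.map_sub, Polynomial.map_mul, Polynomial.map_pow, Polynomial.map_pow,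
      hcr, map_sub, map_mul, map_pow, map_pow, ← hβ, map_C, ← mul_pow, sub_eq_zero,
      Algebra.smul_def, mul_comm, map_mul]
    rfl

theorem PowerSeries.IsWeierstrassFactorization.exists_ringHom_adjoinRoot {O : Type*} [CommRing O]
    [IsLocalRing O] [IsAdicComplete (IsLocalRing.maximalIdeal O) O] {f : O⟦X⟧} {D : O[X]}
    {H : O⟦X⟧} (h : f.IsWeierstrassFactorization D H) :
    ∃ φ : O⟦X⟧ →+* AdjoinRoot D, (∀ p : O[X], φ p = AdjoinRoot.mk D p) ∧
      ∀ x, φ x = 0 ↔ f ∣ x := by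
  let e : AdjoinRoot D ≃ₐ[O] O⟦X⟧ ⧸ Ideal.span {f} := h.algEquivQuotient
  refine ⟨e.symm.toRingHom.comp (Ideal.Quotient.mk (Ideal.span {f})), fun p => ?_, fun x => ?_⟩
  · change e.symm (Ideal.Quotient.mk _ (p : O⟦X⟧)) = _
    rw [AlgEquiv.symm_apply_eq]
    change _ = h.algEquivQuotient (Ideal.Quotient.mk _ p)
    rw [h.algEquivQuotient_apply]
    rfl
  · change e.symm (Ideal.Quotient.mk _ x) = 0 ↔ _
    rw [EmbeddingLike.map_eq_zero_iff, Ideal.Quotient.eq_zero_iff_mem, Ideal.mem_span_singleton]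

theorem PowerSeries.IsWeierstrassFactorization.irreducible_of_prime {O : Type*} [CommRing O]
    [IsDomain O]
    [IsLocalRing O] [IsAdicComplete (IsLocalRing.maximalIdeal O) O] {f : O⟦X⟧} {D : O[X]}
    {H : O⟦X⟧} (h : f.IsWeierstrassFactorization D H) (hf : Prime f) : Irreducible D := by
  obtain ⟨φ, hφ, hφ0⟩ := h.exists_ringHom_adjoinRoot
  have hdvd : ∀ p : O[X], D ∣ p ↔ f ∣ (p : O⟦X⟧) := fun p => by
    rw [← hφ0, hφ, AdjoinRoot.mk_eq_zero]
  refine Prime.irreducible ⟨h.isDistinguishedAt.monic.ne_zero, fun hu => hf.not_isUnit ?_, ?_⟩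
  · exact isUnit_of_dvd_one (by simpa using (hdvd 1).mp hu.dvd)
  · intro a b
    rw [hdvd, hdvd, hdvd, Polynomial.coe_mul]
    exact hf.dvd_or_dvd

/-- Preparation fails only when X divides every coefficient of f. -/
theorem PowerSeries.associated_C_X_or_exists_isWeierstrassFactorization {f : k⟦X⟧⟦X⟧}
    (hf : Irreducible f) :
    Associated (PowerSeries.C (PowerSeries.X : k⟦X⟧)) f ∨
      ∃ D H, f.IsWeierstrassFactorization D H := by
  by_cases h : f.map (IsLocalRing.residue k⟦X⟧) = 0
  · left
    have hdvd : ∀ n, (PowerSeries.X : k⟦X⟧) ∣ PowerSeries.coeff n f := fun n => by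
      rw [← Ideal.mem_span_singleton, ← PowerSeries.maximalIdeal_eq_span_X,
        ← IsLocalRing.residue_eq_zero_iff, ← PowerSeries.coeff_map, h, map_zero]
    choose w hw using hdvd
    have hfw : f = PowerSeries.C (PowerSeries.X : k⟦X⟧) * PowerSeries.mk w := by
      ext1 n
      rw [hw, PowerSeries.coeff_C_mul, PowerSeries.coeff_mk]
    rcases hf.isUnit_or_isUnit hfw with hu | ⟨u, hu⟩
    · rw [PowerSeries.isUnit_iff_constantCoeff, PowerSeries.constantCoeff_C] at hu
      exact absurd hu PowerSeries.X_prime.not_isUnit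
    · exact ⟨u, by rw [hu, ← hfw]⟩
  · exact Or.inr (PowerSeries.exists_isWeierstrassFactorization h)

theorem Polynomial.IsDistinguishedAt.map_constantCoeff_eq_X_pow {D : k⟦X⟧[X]}
    (hD : D.IsDistinguishedAt (IsLocalRing.maximalIdeal k⟦X⟧)) :
    D.map (PowerSeries.constantCoeff (R := k)) = X ^ D.natDegree := by
  ext n
  rw [coeff_map, coeff_X_pow]
  rcases lt_trichotomy n D.natDegree with hn | rfl | hn
  · rw [if_neg hn.ne, ← PowerSeries.X_dvd_iff, ← Ideal.mem_span_singleton,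
      ← PowerSeries.maximalIdeal_eq_span_X]
    exact hD.mem hn
  · simp [hD.monic]
  · simp [hn.ne', coeff_eq_zero_of_natDegree_lt hn]

theorem LaurentSeries.order_eq_zero_of_isUnit {u : k⟦X⟧} (hu : IsUnit u) :
    (algebraMap k⟦X⟧ k⸨X⸩ u).order = 0 := by
  obtain ⟨v, hv⟩ := hu.exists_right_inv
  have h := congrArg (algebraMap k⟦X⟧ k⸨X⸩) hv
  rw [map_mul, map_one] at h
  have hm := HahnSeries.order_mul (left_ne_zero_of_mul_eq_one h) (right_ne_zero_of_mul_eq_one h)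
  rw [h, HahnSeries.order_one] at hm
  have h1 := (LaurentSeries.order_nonneg_iff _).mpr ⟨u, rfl⟩
  have h2 := (LaurentSeries.order_nonneg_iff _).mpr ⟨v, rfl⟩
  omega

theorem LaurentSeries.order_mul_of_isUnit (a : k⟦X⟧) {u : k⟦X⟧} (hu : IsUnit u) :
    (algebraMap k⟦X⟧ k⸨X⸩ (a * u)).order = (algebraMap k⟦X⟧ k⸨X⸩ a).order := by
  rw [map_mul]
  by_cases ha : algebraMap k⟦X⟧ k⸨X⸩ a = 0
  · rw [ha, zero_mul]
  · rw [HahnSeries.order_mul ha (hu.map _).ne_zero, order_eq_zero_of_isUnit hu, add_zero]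

/-- This order is the intersection multiplicity; the unit G contributes nothing. -/
theorem order_norm_of_isWeierstrassFactorization {g G : k⟦X⟧⟦X⟧} {D E : k⟦X⟧[X]}
    (hE : g.IsWeierstrassFactorization E G) (hD : D.Monic)
    (φ : k⟦X⟧⟦X⟧ →+* AdjoinRoot D) (hφ : ∀ p : k⟦X⟧[X], φ p = AdjoinRoot.mk D p) :
    (algebraMap k⟦X⟧ k⸨X⸩ (Algebra.norm k⟦X⟧ (φ g))).order =
      (algebraMap k⟦X⟧ k⸨X⸩ (D.resultant E)).order := by
  rw [hE.eq_mul, map_mul, map_mul, hφ, AdjoinRoot.norm_mk_eq_resultant hD]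
  exact LaurentSeries.order_mul_of_isUnit _ ((hE.isUnit.map φ).map _)

theorem order_norm_of_associated_C_X {g : k⟦X⟧⟦X⟧} {D : k⟦X⟧[X]} (hD : D.Monic)
    (hg : Associated (PowerSeries.C (PowerSeries.X : k⟦X⟧)) g)
    (φ : k⟦X⟧⟦X⟧ →+* AdjoinRoot D) (hφ : ∀ p : k⟦X⟧[X], φ p = AdjoinRoot.mk D p) :
    (algebraMap k⟦X⟧ k⸨X⸩ (Algebra.norm k⟦X⟧ (φ g))).order = D.natDegree := by
  obtain ⟨u, rfl⟩ := hg
  have hfree := hD.free_adjoinRoot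
  have hC : φ (PowerSeries.C PowerSeries.X) = algebraMap k⟦X⟧ (AdjoinRoot D) PowerSeries.X := by
    rw [← Polynomial.coe_C, hφ]
    rfl
  have hfin : Module.finrank k⟦X⟧ (AdjoinRoot D) = D.natDegree :=
    (AdjoinRoot.powerBasis' hD).finrank
  rw [map_mul, map_mul, LaurentSeries.order_mul_of_isUnit _ ((u.isUnit.map φ).map _), hC,
    Algebra.norm_algebraMap, hfin, map_pow, HahnSeries.order_pow, LaurentSeries.order_X,
    nsmul_eq_mul, mul_one]

theorem dvd_order_norm_of_dvd_sub_pow {q : ℕ} {f g h : k⟦X⟧⟦X⟧} {E : k⟦X⟧[X]}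
    (φ : k⟦X⟧⟦X⟧ →+* AdjoinRoot E) (hφ0 : ∀ x, φ x = 0 ↔ g ∣ x) (hfg : g ∣ f - h ^ q) :
    (q : ℤ) ∣ (algebraMap k⟦X⟧ k⸨X⸩ (Algebra.norm k⟦X⟧ (φ f))).order := by
  rw [← hφ0, map_sub, sub_eq_zero, map_pow] at hfg
  rw [hfg, map_pow, map_pow, HahnSeries.order_pow, nsmul_eq_mul]
  exact dvd_mul_right _ _

theorem PowerSeries.exists_pow_eq_X_pow_mul [IsAlgClosed k] {q n : ℕ} (hq : 0 < q)
    (hqk : (q : k) ≠ 0) (hn : q ∣ n) {u : k⟦X⟧} (hu : IsUnit u) :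
    ∃ s : k⟦X⟧, s ^ q = PowerSeries.X ^ n * u := by
  obtain ⟨s, rfl⟩ := exists_pow_eq_of_isUnit (k := k) (B := k⟦X⟧) (τ := PowerSeries.X)
    PowerSeries.X_prime.not_isUnit one_pos (u := 1) (by simp) (fun b => ⟨b.constantCoeff, by
      simp [PowerSeries.X_dvd_iff]⟩) (fun b hb => by
      ext n
      exact (PowerSeries.X_pow_dvd_iff.mp (hb (n + 1))) n (Nat.lt_succ_self n)) hq hqk hu
  obtain ⟨m, rfl⟩ := hn
  exact ⟨PowerSeries.X ^ m * s, by rw [mul_pow, ← pow_mul, mul_comm q]⟩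

theorem PowerSeries.exists_dvd_sub_pow_of_isPowMod [IsAlgClosed k] {q : ℕ} (hq : 0 < q)
    (hqk : (q : k) ≠ 0) {f g : k⟦X⟧⟦X⟧} (hf : Irreducible f) (hg : Irreducible g)
    (hfg : IsPowMod q f g) : ∃ a b, ¬ f ∣ b ∧ f ∣ g * b ^ q - a ^ q := by
  obtain ⟨h, hh⟩ := hfg
  by_cases hdvd : f ∣ g
  · refine ⟨0, 1, fun h => hf.not_isUnit (isUnit_of_dvd_one h), ?_⟩
    simpa [zero_pow hq.ne'] using hdvd
  have hcc : ∀ {x : k⟦X⟧⟦X⟧}, Associated (PowerSeries.C (PowerSeries.X : k⟦X⟧)) x →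
      x.map (PowerSeries.constantCoeff (R := k)) = 0 := by
    rintro _ ⟨u, rfl⟩
    rw [map_mul, PowerSeries.map_C, PowerSeries.constantCoeff_X, map_zero, zero_mul]
  have hW : ∀ {x : k⟦X⟧⟦X⟧} {D H}, x.IsWeierstrassFactorization D H →
      x.map (PowerSeries.constantCoeff (R := k)) =
        PowerSeries.X ^ D.natDegree * H.map (PowerSeries.constantCoeff (R := k)) := by
    intro x D H hx
    conv_lhs => rw [hx.eq_mul]
    rw [map_mul, ← Polynomial.polynomial_map_coe,
      hx.isDistinguishedAt.map_constantCoeff_eq_X_pow, Polynomial.coe_pow, Polynomial.coe_X]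
  rcases associated_C_X_or_exists_isWeierstrassFactorization hf with hfX | ⟨D, H, hD⟩
  · rcases associated_C_X_or_exists_isWeierstrassFactorization hg with hgX | ⟨E, G, hE⟩
    · exact absurd (hfX.symm.trans hgX).dvd hdvd
    · obtain ⟨φ, hφ, hφ0⟩ := hE.exists_ringHom_adjoinRoot
      have hn := dvd_order_norm_of_dvd_sub_pow φ hφ0 hh
      rw [order_norm_of_associated_C_X hE.isDistinguishedAt.monic hfX φ hφ] at hn
      -- Here (f·g) = deg E and g(0, y) = y^(deg E) times a unit, so g has a q-th root on the line X
      -- = 0.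
      obtain ⟨s, hs⟩ := PowerSeries.exists_pow_eq_X_pow_mul hq hqk
        (Int.natCast_dvd_natCast.mp hn) (hE.isUnit.map (PowerSeries.map PowerSeries.constantCoeff))
      rw [← hW hE] at hs
      refine ⟨s.map PowerSeries.C, 1, fun h => hf.not_isUnit (isUnit_of_dvd_one h), ?_⟩
      refine hfX.symm.dvd.trans ?_
      have h0 : (g * 1 ^ q - s.map PowerSeries.C ^ q).map (PowerSeries.constantCoeff (R := k)) =
          0 := by
        rw [one_pow, mul_one, map_sub, map_pow, ← hs, sub_eq_zero]
        rfl
      generalize g * 1 ^ q - s.map PowerSeries.C ^ q = y at h0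
      have hy : ∀ n, (PowerSeries.X : k⟦X⟧) ∣ PowerSeries.coeff n y := fun n => by
        rw [PowerSeries.X_dvd_iff, ← PowerSeries.coeff_map, h0, map_zero]
      choose w hw using hy
      refine ⟨PowerSeries.mk w, ?_⟩
      ext1 n
      rw [hw, PowerSeries.coeff_C_mul, PowerSeries.coeff_mk]
  · obtain ⟨φ, hφ, hφ0⟩ := hD.exists_ringHom_adjoinRoot
    have hDm := hD.isDistinguishedAt.monic
    have hord : (q : ℤ) ∣ (algebraMap k⟦X⟧ k⸨X⸩ (Algebra.norm k⟦X⟧ (φ g))).order := by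
      rcases associated_C_X_or_exists_isWeierstrassFactorization hg with hgX | ⟨E, G, hE⟩
      · rw [order_norm_of_associated_C_X hDm hgX φ hφ]
        -- Restricted to the line X = 0, the congruence reads y^(deg D) · unit = h(0, y)^q, so q
        -- divides deg D.
        obtain ⟨w, hw⟩ := hh
        have h1 := congrArg (PowerSeries.map (PowerSeries.constantCoeff (R := k))) hw
        rw [map_mul, hcc hgX, zero_mul, map_sub, map_pow, sub_eq_zero, hW hD] at h1
        have h2 := congrArg PowerSeries.order h1
        rw [PowerSeries.order_mul, PowerSeries.order_X_pow, PowerSeries.order_pow,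
          PowerSeries.order_zero_of_unit (hD.isUnit.map _), add_zero] at h2
        generalize (h.map (PowerSeries.constantCoeff (R := k))).order = o at h2
        cases o with
        | top => simp [hq.ne'] at h2
        | coe o =>
          refine ⟨o, ?_⟩
          rw [nsmul_eq_mul] at h2
          exact_mod_cast h2
      · obtain ⟨ψ, hψ, hψ0⟩ := hE.exists_ringHom_adjoinRoot
        have hn := dvd_order_norm_of_dvd_sub_pow ψ hψ0 hh
        -- Symmetry of the multiplicity: exchanging D and E changes the resultant only by a sign.
        rw [order_norm_of_isWeierstrassFactorization hD hE.isDistinguishedAt.monic ψ hψ,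
          resultant_comm, mul_comm, LaurentSeries.order_mul_of_isUnit _
            ((isUnit_one (M := k⟦X⟧)).neg.pow _)] at hn
        rwa [order_norm_of_isWeierstrassFactorization hE hDm φ hφ]
    obtain ⟨p, hp⟩ := AdjoinRoot.mk_surjective (φ g)
    rw [← hp] at hord
    obtain ⟨a, b, hb, hab⟩ := exists_pow_modEq_of_dvd_order_norm hq hqk hDm
      (hD.irreducible_of_prime hf.prime)
      (fun h => hdvd ((hφ0 g).mp (hp ▸ AdjoinRoot.mk_eq_zero.mpr h))) hord
    refine ⟨a, b, fun h => hb ?_, ?_⟩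
    · rwa [← hφ0, hφ, AdjoinRoot.mk_eq_zero] at h
    · rw [← hφ0, map_sub, map_mul, map_pow, map_pow, hφ, hφ, ← hp, ← map_pow, ← map_pow,
        ← map_mul, ← map_sub]
      exact AdjoinRoot.mk_eq_zero.mpr hab

end WeierstrassCurves

/-! ### Conditions (a) and (b) as one divisibility -/

section NormalizationPowers

variable {R : Type*} [CommRing R] {f g : R} {q : ℕ}

theorem algebraMap_mk_curveFunctionField_eq_zero (r : R) :
    algebraMap (CurveRing f) (CurveFunctionField f) (Ideal.Quotient.mk (Ideal.span {f}) r) = 0 ↔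
      f ∣ r := by
  rw [map_eq_zero_iff _ (IsFractionRing.injective (CurveRing f) (CurveFunctionField f)),
    Ideal.Quotient.eq_zero_iff_mem, Ideal.mem_span_singleton]

/-- A q-th root in K(A) of an element of A is automatically integral, so only a fraction a / b is
sought. -/
theorem exists_pow_eq_classInNormalization_iff (hf : Prime f) (hq : 0 < q) :
    (∃ u : normalization (CurveRing f), u ^ q = classInNormalization f g) ↔
      ∃ a b, ¬ f ∣ b ∧ f ∣ g * b ^ q - a ^ q := by
  have hprime : (Ideal.span {f}).IsPrime := (Ideal.span_singleton_prime hf.ne_zero).mpr hf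
  have hdom : IsDomain (CurveRing f) := Ideal.Quotient.isDomain _
  let π : R →+* CurveFunctionField f :=
    (algebraMap (CurveRing f) (CurveFunctionField f)).comp (Ideal.Quotient.mk (Ideal.span {f}))
  have hπ : ∀ r, π r = 0 ↔ f ∣ r := algebraMap_mk_curveFunctionField_eq_zero
  have hcond : ∀ a b, ¬ f ∣ b → ((π a / π b) ^ q = π g ↔ f ∣ g * b ^ q - a ^ q) := by
    intro a b hb
    have hb' : π b ≠ 0 := fun h => hb ((hπ b).mp h)
    rw [← hπ, map_sub, map_mul, map_pow, map_pow, sub_eq_zero, div_pow,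
      div_eq_iff (pow_ne_zero _ hb'), eq_comm]
  constructor
  · rintro ⟨u, hu⟩
    have hu' : (u : CurveFunctionField f) ^ q = π g := congrArg Subtype.val hu
    obtain ⟨x, y, hy, hxy⟩ := IsFractionRing.div_surjective (A := CurveRing f)
      (u : CurveFunctionField f)
    obtain ⟨a, rfl⟩ := Ideal.Quotient.mk_surjective x
    obtain ⟨b, rfl⟩ := Ideal.Quotient.mk_surjective y
    have hb : ¬ f ∣ b := by
      rw [← Ideal.mem_span_singleton, ← Ideal.Quotient.eq_zero_iff_mem]
      exact nonZeroDivisors.ne_zero hy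
    exact ⟨a, b, hb, (hcond a b hb).mp (by rw [← hu', ← hxy]; rfl)⟩
  · rintro ⟨a, b, hb, hab⟩
    have h := (hcond a b hb).mpr hab
    refine ⟨⟨π a / π b, IsIntegral.of_pow hq ?_⟩, Subtype.ext h⟩
    rw [h]
    exact isIntegral_algebraMap

theorem exists_fraction_pow_iff [IsDomain R] (hf : Prime f) (hq : 0 < q) :
    (∃ s t : FractionRing R,
        (∃ u : normalization (CurveRing f), HasResidue f s (u : CurveFunctionField f)) ∧
        RegularAlong f t ∧
        algebraMap R (FractionRing R) g - s ^ q = algebraMap R (FractionRing R) f * t) ↔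
      ∃ a b, ¬ f ∣ b ∧ f ∣ g * b ^ q - a ^ q := by
  have hinj := IsFractionRing.injective R (FractionRing R)
  constructor
  · rintro ⟨s, t, ⟨u, a, b, hb, hs, -⟩, ⟨c, d, hd, ht⟩, h⟩
    -- With s = a / b and t = c / d, clearing denominators gives (g b^q - a^q) d = f c b^q, and f ∤
    -- d.
    refine ⟨a, b, hb, (hf.dvd_or_dvd (b := d) ⟨c * b ^ q, hinj ?_⟩).resolve_right hd⟩
    simp only [map_mul, map_sub, map_pow]
    rw [← hs, ← ht]
    linear_combination algebraMap R (FractionRing R) b ^ q * algebraMap R (FractionRing R) d * h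
  · rintro ⟨a, b, hb, c, hc⟩
    obtain ⟨u, hu⟩ := (exists_pow_eq_classInNormalization_iff hf hq).mpr ⟨a, b, hb, c, hc⟩
    have hb0 : algebraMap R (FractionRing R) b ≠ 0 := by
      rw [map_ne_zero_iff _ hinj]
      rintro rfl
      exact hb (dvd_zero f)
    have hprime : (Ideal.span {f}).IsPrime := (Ideal.span_singleton_prime hf.ne_zero).mpr hf
    have hdom : IsDomain (CurveRing f) := Ideal.Quotient.isDomain _
    have hb1 := mt (algebraMap_mk_curveFunctionField_eq_zero (f := f) b).mp hb
    have hab := (algebraMap_mk_curveFunctionField_eq_zero (f := f) _).mpr ⟨c, hc⟩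
    refine ⟨algebraMap R _ a / algebraMap R _ b, algebraMap R _ c / algebraMap R _ b ^ q,
      ⟨⟨_ / _, IsIntegral.of_pow hq ?_⟩, a, b, hb, div_mul_cancel₀ _ hb0, div_mul_cancel₀ _ hb1⟩,
      ⟨c, b ^ q, fun h => hb (hf.dvd_of_dvd_pow h), ?_⟩, ?_⟩
    · rw [map_sub, map_sub, map_mul, map_mul, map_pow, map_pow, map_pow, map_pow,
        sub_eq_zero] at hab
      rw [div_pow, ← hab, mul_div_cancel_right₀ _ (pow_ne_zero _ hb1)]
      exact isIntegral_algebraMap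
    · rw [map_pow, div_mul_cancel₀ _ (pow_ne_zero _ hb0)]
    · have := congrArg (algebraMap R (FractionRing R)) hc
      simp only [map_mul, map_sub, map_pow] at this
      rw [mul_div_assoc', eq_div_iff (pow_ne_zero _ hb0), sub_mul, ← mul_pow,
        div_mul_cancel₀ _ hb0, this]

end NormalizationPowers

/-! ### Transfer to k[[x]][[y]] and conclusion -/

section TwoVariables

open scoped PowerSeries

/-- The identification of `k[[x, y]]` with the iterated power series ring `k[[x]][[y]]`. -/
noncomputable def MvPowerSeries.finTwoEquiv (k : Type*) [CommRing k] :
    MvPowerSeries (Fin 2) k ≃+* k⟦X⟧⟦X⟧ :=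
  let e : MvPowerSeries (Fin 1) k ≃+* k⟦X⟧ :=
    (MvPowerSeries.renameEquiv k (Equiv.ofUnique (Fin 1) Unit)).toRingEquiv
  (MvPowerSeries.finSuccEquiv k 1).toRingEquiv.trans
    (RingEquiv.ofRingHom (PowerSeries.map e.toRingHom) (PowerSeries.map e.symm.toRingHom)
      (by ext; simp) (by ext; simp))

end TwoVariables

theorem mainTheorem2 {k : Type*} [Field k] [IsAlgClosed k] (q : ℕ) (hq : q.Prime)
    (hqk : q ≠ ringChar k) (f g : PowerSeriesXY k) (hf : Irreducible f) (hg : Irreducible g) :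
    (IsPowMod q f g →
      (∃ u : normalization (CurveRing f), u ^ q = classInNormalization f g) ∧
      (∃ s t : FractionRing (PowerSeriesXY k),
        (∃ u : normalization (CurveRing f), HasResidue f s (u : CurveFunctionField f)) ∧
        RegularAlong f t ∧
        algebraMap (PowerSeriesXY k) (FractionRing (PowerSeriesXY k)) g - s ^ q =
          algebraMap (PowerSeriesXY k) (FractionRing (PowerSeriesXY k)) f * t)) ∧
    ((∃ u : normalization (CurveRing f), u ^ q = classInNormalization f g) ↔
      (∃ s t : FractionRing (PowerSeriesXY k),
        (∃ u : normalization (CurveRing f), HasResidue f s (u : CurveFunctionField f)) ∧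
        RegularAlong f t ∧
        algebraMap (PowerSeriesXY k) (FractionRing (PowerSeriesXY k)) g - s ^ q =
          algebraMap (PowerSeriesXY k) (FractionRing (PowerSeriesXY k)) f * t)) := by
  let e := MvPowerSeries.finTwoEquiv k
  have hef : Irreducible (e f) := (MulEquiv.irreducible_iff e).mpr hf
  have heg : Irreducible (e g) := (MulEquiv.irreducible_iff e).mpr hg
  have hprime : Prime f := (MulEquiv.prime_iff e).mp hef.prime
  have hqk' : (q : k) ≠ 0 := by
    intro h
    rcases (Nat.dvd_prime hq).mp ((ringChar.spec k q).mp h) with h1 | h1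
    · exact CharP.ringChar_ne_one h1
    · exact hqk h1.symm
  have hdom : IsDomain (PowerSeriesXY k) := NoZeroDivisors.to_isDomain _
  rw [exists_pow_eq_classInNormalization_iff hprime hq.pos, exists_fraction_pow_iff hprime hq.pos]
  refine ⟨fun ⟨h, hh⟩ => and_self_iff.mpr ?_, Iff.rfl⟩
  obtain ⟨a, b, hb, hab⟩ := PowerSeries.exists_dvd_sub_pow_of_isPowMod hq.pos hqk' hef heg
    ⟨e h, by simpa using map_dvd e hh⟩
  refine ⟨e.symm a, e.symm b, fun h => hb (by simpa using map_dvd e h), ?_⟩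
  simpa using map_dvd e.symm hab
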